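/- For $1\le p<\infty$ let $X^p(\mathbb{R}_+)$ be the space of (classes of) measurable functions $f:\mathbb{R}_+\to\mathbb{C}$ with $\|f\|_{X^p}=\left(\int_0^\infty |f(x)|^p\,\frac{dx}{x}\right)^{1/p}<\infty$. On it consider the $C_0$-group of isometries $U(t)f(x)=f(e^t x)$, $t\in\mathbb{R}$, and let $\Theta=x\frac{d}{dx}$ be its infinitesimal generator, with $\mathcal{D}^k(\Theta)$ the domain of $\Theta^k$ and $\mathcal{D}^\infty(\Theta)=\bigcap_k\mathcal{D}^k(\Theta)$. For $\sigma>0$ the Bernstein space $\mathbf{B}^p_\sigma(\Theta)$ is the set of all $f\in\mathcal{D}^\infty(\Theta)$ with $\|\Theta^k f\|_{X^p}\le\sigma^k\|f\|_{X^p}$ for all $k\in\mathbb{N}$. For $\sigma>0$ and $m\ge 1$ the Riesz–Boas operators are $$\mathcal{R}^{(2m-1)}(\sigma)f(x)=\left(\frac{\sigma}{\pi}\right)^{2m-1}\sum_{k\in\mathbb{Z}}(-1)^{k+1}A_{m,k}\,f\!\left(e^{\frac{\pi}{\sigma}(k-1/2)}x\right),\qquad \mathcal{R}^{(2m)}(\sigma)f(x)=\left(\frac{\sigma}{\pi}\right)^{2m}\sum_{k\in\mathbb{Z}}(-1)^{k+1}B_{m,k}\,f\!\left(e^{\frac{\pi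 k}{\sigma}}x\right),$$ the sums being taken in $X^p(\mathbb{R}_+)$, where $$A_{m,k}=\frac{(2m-1)!}{\pi(k-\frac12)^{2m}}\sum_{j=0}^{m-1}\frac{(-1)^j}{(2j)!}\left(\pi(k-\tfrac12)\right)^{2j}\quad(k\in\mathbb{Z}),$$ $$B_{m,k}=\frac{(2m)!}{\pi k^{2m+1}}\sum_{j=0}^{m-1}\frac{(-1)^j(\pi k)^{2j+1}}{(2j+1)!}\quad(k\in\mathbb{Z}\setminus\{0\}),\qquad B_{m,0}=(-1)^{m+1}\frac{\pi^{2m}}{2m+1}.$$ **Statement.** Let $1<p<\infty$, $\sigma>0$ and $f\in\mathbf{B}^p_\sigma(\Theta)$. Then for all $\sigma_1\ge\sigma$, $\sigma_2\ge\sigma$ and every integer $r\ge1$ the series defining $\mathcal{R}^{(r)}(\sigma_1)f$ and $\mathcal{R}^{(r)}(\sigma_2)f$ converge unconditionally in $X^p(\mathbb{R}_+)$, and $$\mathcal{R}^{(r)}(\sigma_1)f=\mathcal{R}^{(r)}(\sigma_2)f .$$ -/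

import Mathlib

open MeasureTheory Set
open scoped ENNReal

noncomputable section

namespace Mellin11

/-- The measure `dx / x` on the half-line `(0, ∞)`, as a measure on `ℝ` carried by `(0, ∞)`. -/
def mellinMeasure : Measure ℝ :=
  (volume.restrict (Ioi 0)).withDensity fun x => ENNReal.ofReal x⁻¹

/-- The norm of `L^p(dx / x)` is the norm `‖x ^ (-1/p) f(x)‖_{L^p(0, ∞)}`. -/
theorem eLpNorm_mellinMeasure (p : ℝ≥0∞) (hp : 1 ≤ p) (hp' : p < ∞) (f : ℝ → ℂ) :
    eLpNorm f p mellinMeasure =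
      eLpNorm (fun x => f x * ((x ^ (-1 / p.toReal) : ℝ) : ℂ)) p (volume.restrict (Ioi 0)) := by
  have h0 : p ≠ 0 := (zero_lt_one.trans_le hp).ne'
  have hpos : 0 < p.toReal := ENNReal.toReal_pos h0 hp'.ne
  rw [eLpNorm_eq_lintegral_rpow_enorm_toReal h0 hp'.ne,
    eLpNorm_eq_lintegral_rpow_enorm_toReal h0 hp'.ne]
  congr 1
  unfold mellinMeasure
  rw [lintegral_withDensity_eq_lintegral_mul_non_measurable _
    (by fun_prop) (by simp)]
  refine setLIntegral_congr_fun measurableSet_Ioi fun x hx => ?_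
  have hx : 0 < x := hx
  simp only [Pi.mul_apply, enorm_mul, ENNReal.mul_rpow_of_nonneg _ _ hpos.le]
  rw [mul_comm]
  congr 1
  have h1 : ‖((x ^ (-1 / p.toReal) : ℝ) : ℂ)‖ₑ = ENNReal.ofReal (x ^ (-1 / p.toReal)) := by
    rw [← ofReal_norm, Complex.norm_real, Real.norm_of_nonneg (by positivity)]
  rw [h1, ENNReal.ofReal_rpow_of_nonneg (by positivity) hpos.le, ← Real.rpow_mul hx.le,
    div_mul_cancel₀ _ hpos.ne', Real.rpow_neg_one]

/-- The measure `dx / x` is invariant under the dilations `x ↦ e^t x`. -/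
theorem measurePreserving_dilation (t : ℝ) :
    MeasurePreserving (fun x : ℝ => Real.exp t * x) mellinMeasure mellinMeasure := by
  have hm : Measurable fun x : ℝ => Real.exp t * x := by fun_prop
  refine ⟨hm, ?_⟩
  ext s hs
  rw [Measure.map_apply hm hs]
  unfold mellinMeasure
  rw [withDensity_apply _ hs, withDensity_apply _ (hm hs), Measure.restrict_restrict hs,
    Measure.restrict_restrict (hm hs)]
  have hpos := Real.exp_pos t
  have himg : s ∩ Ioi 0 = (fun x : ℝ => Real.exp t * x) ''
      ((fun x : ℝ => Real.exp t * x) ⁻¹' s ∩ Ioi 0) := by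
    ext y
    constructor
    · rintro ⟨hy, hy0⟩
      have hy0 : 0 < y := hy0
      have hc : Real.exp t * ((Real.exp t)⁻¹ * y) = y := by field_simp
      exact ⟨(Real.exp t)⁻¹ * y, ⟨by simpa [hc] using hy, by simpa using (by positivity)⟩, hc⟩
    · rintro ⟨x, ⟨hx, hx0⟩, rfl⟩
      exact ⟨hx, mul_pos hpos hx0⟩
  rw [himg, lintegral_image_eq_lintegral_abs_deriv_mul ((hm hs).inter measurableSet_Ioi)
    (f' := fun _ => Real.exp t)
    (fun x _ => by simpa using ((hasDerivAt_id x).const_mul (Real.exp t)).hasDerivWithinAt)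
    (fun a _ b _ h => mul_left_cancel₀ hpos.ne' h)]
  refine setLIntegral_congr_fun ((hm hs).inter measurableSet_Ioi) fun x hx => ?_
  have hx : 0 < x := hx.2
  rw [abs_of_pos hpos, ← ENNReal.ofReal_mul hpos.le, mul_inv, mul_inv_cancel_left₀ hpos.ne']

/-- The Lebesgue-Mellin space `X^p`, that is `L^p((0, ∞), dx / x)`. -/
abbrev X (p : ℝ≥0∞) : Type := Lp ℂ p mellinMeasure

section

variable {p : ℝ≥0∞} [Fact (1 ≤ p)]

/-- The Mellin translation `(U(t) f)(x) = f(e^t x)`. -/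
def U (t : ℝ) (f : X p) : X p :=
  Lp.compMeasurePreserving (fun x : ℝ => Real.exp t * x) (measurePreserving_dilation t) f

/-- The domain of the infinitesimal generator of `U`: those `f` for which the difference quotient
`(U(t) f - f) / t` converges in `X^p` as `t → 0`. -/
def InDomain (f : X p) : Prop := DifferentiableAt ℝ (fun t : ℝ => U t f) 0

/-- The infinitesimal generator `Θ = x d/dx` of `U` (meaningful on the domain `InDomain`). -/
def Theta (f : X p) : X p := deriv (fun t : ℝ => U t f) 0

/-- The domain `D^k(Θ)` of the power `Θ^k`. -/
def domainPow (k : ℕ) : Set (X p) := {f | ∀ j < k, InDomain (Theta^[j] f)}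

/-- The set `D^∞(Θ) = ⋂ₖ D^k(Θ)`. -/
def domainInfty : Set (X p) := ⋂ k : ℕ, domainPow k

/-- The Bernstein space `B_σ^p(Θ)`. -/
def bernstein (p : ℝ≥0∞) [Fact (1 ≤ p)] (σ : ℝ) : Set (X p) :=
  {f | f ∈ domainInfty ∧ ∀ k : ℕ, ‖Theta^[k] f‖ ≤ σ ^ k * ‖f‖}

/-- The coefficients `A_{m,k}`. -/
def coeffA (m : ℕ) (k : ℤ) : ℝ :=
  ((2 * m - 1).factorial : ℝ) / (Real.pi * ((k : ℝ) - 1 / 2) ^ (2 * m)) *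
    ∑ j ∈ Finset.range m,
      (-1 : ℝ) ^ j / ((2 * j).factorial : ℝ) * (Real.pi * ((k : ℝ) - 1 / 2)) ^ (2 * j)

/-- The coefficients `B_{m,k}`. -/
def coeffB (m : ℕ) (k : ℤ) : ℝ :=
  if k = 0 then (-1 : ℝ) ^ (m + 1) * (Real.pi ^ (2 * m) / (2 * m + 1))
  else ((2 * m).factorial : ℝ) / (Real.pi * (k : ℝ) ^ (2 * m + 1)) *
    ∑ j ∈ Finset.range m,
      (-1 : ℝ) ^ j * (Real.pi * (k : ℝ)) ^ (2 * j + 1) / ((2 * j + 1).factorial : ℝ)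

/-- The `k`-th term of the series for `R^{(r)}(σ) f`; here `r = 2 m - 1` if `r` is odd and
`r = 2 m` if `r` is even. -/
def rieszBoasTerm (r : ℕ) (σ : ℝ) (f : X p) (k : ℤ) : X p :=
  if Odd r then
    ((σ / Real.pi) ^ r * ((-1 : ℝ) ^ (k + 1) * coeffA ((r + 1) / 2) k)) •
      U (Real.pi / σ * ((k : ℝ) - 1 / 2)) f
  else
    ((σ / Real.pi) ^ r * ((-1 : ℝ) ^ (k + 1) * coeffB (r / 2) k)) •
      U (Real.pi * (k : ℝ) / σ) f

/-- The Riesz-Boas operator `R^{(r)}(σ)`, the sum of its series in `X^p`. -/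
def rieszBoas (r : ℕ) (σ : ℝ) (f : X p) : X p := ∑' k : ℤ, rieszBoasTerm r σ f k

end

end Mellin11

end

/-!
Along the orbit `t ↦ U t f` of `f` in the Bernstein space, all derivatives obey Bernstein's
inequality, so that after pairing with a functional the orbit extends to an entire function of
exponential type at most `σ₁`, bounded on the real line. For such an `h`, rescaled to type `π`, the
Riesz-Boas series is the sampling series of `h⁽ʳ⁾(0)`: subtracting Taylor polynomials from `h` and
from `sin (π z)` or `cos (π z)` produces an entire function of type `π` that decays like `z⁻²`, and
the alternating sum of such a function over the integers vanishes by Poisson summation, because its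
Fourier transform is supported in `[-π, π]`. Hence both operators coincide with `Θʳ` on `f`,
whatever `σ₁` and `σ₂` are.
-/

namespace Mellin11

open Asymptotics Bornology Filter Topology Complex
open scoped Real ContDiff

/-! ### Exponential growth along the imaginary axis -/

/-- `HasExpGrowth σ n g` says that `g` is `O(‖z‖ ^ n * exp (σ |Im z|))` at infinity: exponential
type `σ` along the imaginary axis, and polynomial growth (`0 ≤ n`) or decay (`n < 0`) along the
real axis. -/
def HasExpGrowth (σ : ℝ) (n : ℤ) (g : ℂ → ℂ) : Prop :=
  g =O[cobounded ℂ] fun z => ‖z‖ ^ n * Real.exp (σ * |z.im|)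

namespace HasExpGrowth

variable {σ σ' : ℝ} {n n' : ℤ} {g g' : ℂ → ℂ}

theorem add (h : HasExpGrowth σ n g) (h' : HasExpGrowth σ n g') :
    HasExpGrowth σ n fun z => g z + g' z :=
  IsBigO.add h h'

theorem sub (h : HasExpGrowth σ n g) (h' : HasExpGrowth σ n g') :
    HasExpGrowth σ n fun z => g z - g' z :=
  IsBigO.sub h h'

theorem const_mul (h : HasExpGrowth σ n g) (c : ℂ) : HasExpGrowth σ n fun z => c * g z :=
  h.const_mul_left c

theorem mul (h : HasExpGrowth σ n g) (h' : HasExpGrowth σ' n' g') :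
    HasExpGrowth (σ + σ') (n + n') fun z => g z * g' z := by
  refine (IsBigO.mul h h').trans_eventuallyEq ?_
  filter_upwards [eventually_ne_cobounded 0] with z hz
  rw [zpow_add₀ (norm_ne_zero_iff.2 hz), add_mul, Real.exp_add]
  ring

theorem mono (h : HasExpGrowth σ n g) (hn : n ≤ n') : HasExpGrowth σ n' g := by
  refine h.trans (IsBigO.of_bound' ?_)
  filter_upwards [eventually_cobounded_le_norm 1] with z hz
  rw [norm_mul, norm_mul, norm_zpow, norm_zpow, norm_norm]
  gcongr

theorem of_eventually_pow_mul_eq {N : ℕ} (h : HasExpGrowth σ n g)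
    (hg' : ∀ᶠ z in cobounded ℂ, z ^ N * g' z = g z) : HasExpGrowth σ (n - N) g' := by
  have hpow : HasExpGrowth 0 (-N) fun z => (z ^ N)⁻¹ :=
    IsBigO.of_norm_le fun z => by simp
  have hprod := hpow.mul h
  rw [zero_add, neg_add_eq_sub] at hprod
  refine hprod.congr' ?_ .rfl
  filter_upwards [hg', eventually_ne_cobounded 0] with z hz hz0
  rw [← hz, inv_mul_cancel_left₀ (pow_ne_zero N hz0)]

theorem dslope_zero (h : HasExpGrowth σ n g) (h0 : g 0 = 0) :
    HasExpGrowth σ (n - 1) (dslope g 0) :=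
  of_eventually_pow_mul_eq (N := 1) h <| .of_forall fun z => by
    simpa [h0] using sub_smul_dslope g 0 z

theorem comp_ofReal_mul (h : HasExpGrowth σ n g) {c : ℝ} (hc : 0 < c) :
    HasExpGrowth (σ * c) n fun z => g (c * z) := by
  have htendsto := tendsto_mul_left_cobounded (ofReal_ne_zero.2 hc.ne')
  refine (h.comp_tendsto htendsto).trans (IsBigO.of_bound (c ^ n) (.of_forall fun z => ?_))
  simp only [Function.comp_apply, norm_mul, im_ofReal_mul, abs_mul, mul_zpow, norm_zpow, norm_norm,
    norm_real, Real.norm_of_nonneg hc.le, abs_of_pos hc, Real.norm_of_nonneg (Real.exp_pos _).le]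
  rw [mul_assoc, mul_assoc σ]

theorem comp_neg (h : HasExpGrowth σ n g) : HasExpGrowth σ n fun z => g (-z) :=
  (h.comp_tendsto tendsto_neg_cobounded).congr_right fun z => by simp

theorem exists_norm_le_div (h : HasExpGrowth σ (-2) g) (hg : Continuous g) :
    ∃ C, ∀ z, ‖g z‖ ≤ C * Real.exp (σ * |z.im|) / (1 + ‖z‖ ^ 2) := by
  set w : ℂ → ℝ := fun z => Real.exp (σ * |z.im|) / (1 + ‖z‖ ^ 2) with hw
  have hwpos (z : ℂ) : 0 < w z := by positivity
  have hwcont : Continuous w :=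
    Continuous.div (by fun_prop) (by fun_prop) fun z => by positivity
  have hinfty : g =O[cobounded ℂ] w := by
    refine h.trans (IsBigO.of_bound 2 ?_)
    filter_upwards [eventually_cobounded_le_norm 1] with z hz
    rw [Real.norm_of_nonneg (by positivity), Real.norm_of_nonneg (hwpos z).le, hw, zpow_neg,
      ← div_eq_inv_mul, ← mul_div_assoc, div_le_div_iff₀ (by positivity) (by positivity)]
    have hz2 : 1 ≤ ‖z‖ ^ 2 := one_le_pow₀ hz
    have := Real.exp_pos (σ * |z.im|)
    norm_cast
    nlinarith
  obtain ⟨C₁, hC₁⟩ := hinfty.bound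
  rw [Metric.cobounded_eq_cocompact] at hC₁
  obtain ⟨K, hK, hKC⟩ := mem_cocompact.1 hC₁
  obtain ⟨C₂, hC₂⟩ := hK.exists_bound_of_continuousOn (f := fun z => g z / w z)
    (hg.div (continuous_ofReal.comp hwcont) fun z => ofReal_ne_zero.2 (hwpos z).ne').continuousOn
  refine ⟨max C₁ C₂, fun z => ?_⟩
  rw [mul_div_assoc]
  by_cases hz : z ∈ K
  · have hquot := hC₂ z hz
    rw [norm_div, norm_real, Real.norm_of_nonneg (hwpos z).le, div_le_iff₀ (hwpos z)] at hquot
    exact hquot.trans (mul_le_mul_of_nonneg_right (le_max_right _ _) (hwpos z).le)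
  · have hbound := hKC hz
    rw [mem_ofPred_eq, Real.norm_of_nonneg (hwpos z).le] at hbound
    exact hbound.trans (mul_le_mul_of_nonneg_right (le_max_left _ _) (hwpos z).le)

end HasExpGrowth

theorem hasExpGrowth_pow (k : ℕ) : HasExpGrowth 0 k fun z => z ^ k :=
  IsBigO.of_norm_le fun z => by simp

theorem hasExpGrowth_exp_mul_I : HasExpGrowth 1 0 fun z => exp (z * I) :=
  IsBigO.of_norm_le fun z => by simpa [norm_exp] using neg_le_abs z.im

theorem hasExpGrowth_cos : HasExpGrowth 1 0 cos :=
  ((hasExpGrowth_exp_mul_I.add hasExpGrowth_exp_mul_I.comp_neg).const_mul 2⁻¹).congr_left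
    fun z => by rw [cos]; ring

theorem hasExpGrowth_sin : HasExpGrowth 1 0 sin :=
  ((hasExpGrowth_exp_mul_I.comp_neg.sub hasExpGrowth_exp_mul_I).const_mul (I / 2)).congr_left
    fun z => by rw [sin]; ring

theorem hasExpGrowth_sin_pi_mul : HasExpGrowth π 0 fun z => sin (π * z) := by
  simpa using hasExpGrowth_sin.comp_ofReal_mul Real.pi_pos

theorem hasExpGrowth_cos_pi_mul : HasExpGrowth π 0 fun z => cos (π * z) := by
  simpa using hasExpGrowth_cos.comp_ofReal_mul Real.pi_pos

/-! ### Alternating sums over the integers -/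

section ContourShift

variable {E : Type*} [NormedAddCommGroup E] [NormedSpace ℂ E] {G : ℂ → E}

theorem tendsto_intervalIntegral_vertical_zero {ι : Type*} {l : Filter ι} {R : ι → ℝ}
    (hR : Tendsto R l (cocompact ℝ)) {b : ℝ → ℝ} {y : ℝ} (hb : Tendsto b (cocompact ℝ) (𝓝 0))
    (hGb : ∀ z : ℂ, z.im ∈ uIcc 0 y → ‖G z‖ ≤ b z.re) :
    Tendsto (fun i => ∫ s in (0 : ℝ)..y, G (R i + s * I)) l (𝓝 0) := by
  have hnorm (i : ι) : ‖∫ s in (0 : ℝ)..y, G (R i + s * I)‖ ≤ b (R i) * |y - 0| :=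
    intervalIntegral.norm_integral_le_of_norm_le_const fun s hs => by
      simpa using hGb (R i + s * I) (by simpa using uIoc_subset_uIcc hs)
  exact squeeze_zero_norm hnorm (by simpa using (hb.comp hR).mul_const |y - 0|)

theorem integral_eq_integral_add_mul_I [CompleteSpace E] {b : ℝ → ℝ} {y : ℝ}
    (hG : DifferentiableOn ℂ G (im ⁻¹' uIcc 0 y)) (hbi : Integrable b)
    (hb : Tendsto b (cocompact ℝ) (𝓝 0)) (hGb : ∀ z : ℂ, z.im ∈ uIcc 0 y → ‖G z‖ ≤ b z.re) :
    ∫ x : ℝ, G x = ∫ x : ℝ, G (x + y * I) := by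
  have hline {s : ℝ} (hs : s ∈ uIcc 0 y) :
      Tendsto (fun R : ℝ => ∫ x in -R..R, G (x + s * I)) atTop (𝓝 (∫ x : ℝ, G (x + s * I))) := by
    have hcont : Continuous fun x : ℝ => G (x + s * I) :=
      hG.continuousOn.comp_continuous (by fun_prop) fun x => by simpa using hs
    have hint : Integrable fun x : ℝ => G (x + s * I) :=
      hbi.mono' hcont.aestronglyMeasurable <| .of_forall fun x => by
        simpa using hGb (x + s * I) (by simpa using hs)
    exact intervalIntegral_tendsto_integral hint tendsto_neg_atTop_atBot tendsto_id
  have hrectangle (R : ℝ) : (∫ x in -R..R, G (x + (0 : ℝ) * I)) =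
      (∫ x in -R..R, G (x + y * I)) - I • (∫ s in (0 : ℝ)..y, G (R + s * I)) +
        I • ∫ s in (0 : ℝ)..y, G ((-R : ℝ) + s * I) := by
    have hrect := integral_boundary_rect_eq_zero_of_differentiableOn G ((-R : ℝ) : ℂ) (R + y * I)
      (hG.mono fun z hz => by simpa using hz.2)
    simp only [ofReal_im, ofReal_re, add_re, mul_re, I_re, mul_zero, I_im, mul_one, sub_self,
      add_zero, add_im, mul_im, zero_add] at hrect
    rw [← sub_eq_zero, ← hrect]
    abel
  have hright := tendsto_intervalIntegral_vertical_zero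
    (tendsto_id.mono_right atTop_le_cocompact) hb hGb
  have hleft := tendsto_intervalIntegral_vertical_zero
    (tendsto_neg_atTop_atBot.mono_right atBot_le_cocompact) hb hGb
  have hlim := ((hline right_mem_uIcc).sub (hright.const_smul I)).add (hleft.const_smul I)
  simp only [id, ← hrectangle, smul_zero, sub_zero, add_zero] at hlim
  simpa using tendsto_nhds_unique (hline left_mem_uIcc) hlim

theorem tendsto_const_div_one_add_sq_cocompact (C : ℝ) :
    Tendsto (fun x : ℝ => C / (1 + x ^ 2)) (cocompact ℝ) (𝓝 0) := by
  refine Tendsto.const_div_atTop (tendsto_atTop_add_const_left _ _ ?_) C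
  exact ((tendsto_pow_atTop two_ne_zero).comp (tendsto_norm_cocompact_atTop (E := ℝ))).congr
    fun x => sq_abs x

theorem integral_eq_zero_of_norm_le_upperHalfPlane [CompleteSpace E] {C : ℝ}
    (hG : DifferentiableOn ℂ G {z | 0 ≤ z.im})
    (hGb : ∀ z : ℂ, 0 ≤ z.im → ‖G z‖ ≤ C / (1 + ‖z‖ ^ 2)) : ∫ x : ℝ, G x = 0 := by
  have hC : 0 ≤ C := by simpa using (norm_nonneg _).trans (hGb 0 le_rfl)
  have hbi : Integrable fun x : ℝ => C / (1 + x ^ 2) := integrable_inv_one_add_sq.const_mul C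
  have hGre (z : ℂ) (hz : 0 ≤ z.im) : ‖G z‖ ≤ C / (1 + z.re ^ 2) := by
    refine (hGb z hz).trans ?_
    gcongr C / (1 + ?_)
    exact sq_le_sq.2 ((abs_re_le_norm z).trans (le_abs_self _))
  have hshift (n : ℕ) : ∫ x : ℝ, G x = ∫ x : ℝ, G (x + (n : ℝ) * I) := by
    have hstrip (z : ℂ) (hz : z.im ∈ uIcc (0 : ℝ) n) : 0 ≤ z.im :=
      (uIcc_of_le (Nat.cast_nonneg (α := ℝ) n) ▸ hz).1
    exact integral_eq_integral_add_mul_I (hG.mono hstrip) hbi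
      (tendsto_const_div_one_add_sq_cocompact C) fun z hz => hGre z (hstrip z hz)
  have hpointwise (x : ℝ) : Tendsto (fun n : ℕ => G (x + (n : ℝ) * I)) atTop (𝓝 0) := by
    have hb (n : ℕ) : ‖G (x + (n : ℝ) * I)‖ ≤ C / (1 + (n : ℝ) ^ 2) := by
      refine (hGb _ (by simp)).trans ?_
      gcongr
      simpa using abs_im_le_norm (x + (n : ℝ) * I)
    exact squeeze_zero_norm hb ((tendsto_const_div_one_add_sq_cocompact C).comp
      (tendsto_natCast_atTop_atTop.mono_right atTop_le_cocompact))
  have hlim : Tendsto (fun n : ℕ => ∫ x : ℝ, G (x + (n : ℝ) * I)) atTop (𝓝 (∫ _ : ℝ, (0 : E))) :=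
    tendsto_integral_of_dominated_convergence _
      (fun n => (hG.continuousOn.comp_continuous (by fun_prop)
        fun x => by simp).aestronglyMeasurable) hbi
      (fun n => .of_forall fun x => by simpa using hGre (x + (n : ℝ) * I) (by simp))
      (.of_forall hpointwise)
  simp only [← hshift, integral_zero] at hlim
  exact tendsto_nhds_unique tendsto_const_nhds hlim

end ContourShift

theorem HasExpGrowth.integral_mul_exp_eq_zero {σ : ℝ} {g : ℂ → ℂ} (h : HasExpGrowth σ (-2) g)
    (hg : Differentiable ℂ g) {c : ℝ} (hc : σ ≤ |c|) : ∫ x : ℝ, g x * exp (I * c * x) = 0 := by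
  wlog hc0 : 0 ≤ c generalizing g c
  · rw [← integral_neg_eq_self]
    simpa using this h.comp_neg (by fun_prop) (c := -c) (by rwa [abs_neg]) (by linarith)
  rw [abs_of_nonneg hc0] at hc
  obtain ⟨C, hC⟩ := h.exists_norm_le_div hg.continuous
  have hC0 : 0 ≤ C := by simpa using (norm_nonneg _).trans (hC 0)
  refine integral_eq_zero_of_norm_le_upperHalfPlane (G := fun z => g z * exp (I * c * z)) (C := C)
    (by fun_prop) fun z hz => ?_
  have hexp : ‖exp (I * c * z)‖ = Real.exp (-(c * z.im)) := by simp [norm_exp]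
  calc ‖g z * exp (I * c * z)‖
      ≤ C * Real.exp (σ * |z.im|) / (1 + ‖z‖ ^ 2) * Real.exp (-(c * z.im)) := by
        rw [norm_mul, hexp]; gcongr; exact hC z
    _ = C * Real.exp ((σ - c) * z.im) / (1 + ‖z‖ ^ 2) := by
        rw [abs_of_nonneg hz, div_mul_eq_mul_div, mul_assoc, ← Real.exp_add]; ring_nf
    _ ≤ C / (1 + ‖z‖ ^ 2) := by
        gcongr
        exact mul_le_of_le_one_right hC0
          (Real.exp_le_one_iff.2 (mul_nonpos_of_nonpos_of_nonneg (sub_nonpos.2 hc) hz))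

/-- By Poisson summation the sum is that of the Fourier transform of `g` over the odd multiples
of `π`, all of which lie outside the spectrum of `g` or at its end points. -/
theorem HasExpGrowth.hasSum_neg_one_zpow_mul {g : ℂ → ℂ} (h : HasExpGrowth π (-2) g)
    (hg : Differentiable ℂ g) : HasSum (fun k : ℤ => (-1 : ℂ) ^ k * g k) 0 := by
  set f : ℝ → ℂ := fun x => g x * exp (I * π * x) with hf
  have hcont : Continuous f := by have := hg.continuous; fun_prop
  have hdecay : f =O[cocompact ℝ] fun x : ℝ => |x| ^ (-2 : ℝ) := by
    rw [← Metric.cobounded_eq_cocompact]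
    have hgrowth := h.comp_tendsto isometry_ofReal.antilipschitz.tendsto_cobounded
    refine isBigO_norm_left.1 (hgrowth.norm_left.congr (fun x => ?_) fun x => ?_)
    · simp [hf, norm_exp]
    · simp
  have hfourier (n : ℤ) : FourierTransform.fourier f (n : ℝ) = 0 := by
    have hfreq : π ≤ |π * (1 - 2 * n)| := by
      rw [abs_mul, abs_of_pos Real.pi_pos]
      refine le_mul_of_one_le_right Real.pi_pos.le ?_
      exact_mod_cast Int.one_le_abs (show (1 : ℤ) - 2 * n ≠ 0 by omega)
    rw [Real.fourier_real_eq_integral_exp_smul, ← h.integral_mul_exp_eq_zero hg hfreq]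
    congr 1 with x
    rw [smul_eq_mul, hf, mul_left_comm, ← exp_add]
    congr 2
    push_cast
    ring
  have hsum : Summable fun k : ℤ => f k :=
    summable_of_isBigO (Real.summable_abs_int_rpow one_lt_two)
      (hdecay.comp_tendsto Int.tendsto_coe_cofinite)
  have hpoisson := Real.tsum_eq_tsum_fourier_of_rpow_decay_of_summable hcont one_lt_two hdecay
    (by simpa only [hfourier] using summable_zero) 0
  simp only [zero_add, hfourier, zero_mul, tsum_zero] at hpoisson
  refine (hpoisson ▸ hsum.hasSum).congr_fun fun k => ?_
  have hexp : exp (I * π * k) = (-1) ^ k := by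
    rw [← exp_pi_mul_I, ← exp_int_mul]; ring_nf
  simp [hf, hexp, mul_comm]

theorem differentiable_dslope {h : ℂ → ℂ} (hh : Differentiable ℂ h) (c : ℂ) :
    Differentiable ℂ (dslope h c) :=
  differentiableOn_univ.1 ((differentiableOn_dslope univ_mem).2 hh.differentiableOn)

theorem intCast_sub_half_ne_zero (k : ℤ) : (k : ℂ) - 1 / 2 ≠ 0 := fun h => by
  have hodd : (2 * k - 1 : ℂ) = 0 := by linear_combination 2 * h
  have hodd' : 2 * k - 1 = 0 := by exact_mod_cast hodd
  omega

theorem sin_pi_mul_intCast (k : ℤ) : sin (π * k) = 0 := by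
  rw [mul_comm, sin_int_mul_pi]

theorem cos_pi_mul_intCast (k : ℤ) : cos (π * k) = (-1) ^ k := by
  simpa [mul_comm] using congr_arg ofReal (Real.cos_int_mul_pi k)

theorem sin_pi_mul_intCast_sub_half (k : ℤ) : sin (π * (k - 1 / 2)) = -(-1) ^ k := by
  rw [mul_sub, mul_one_div, sin_sub_pi_div_two, cos_pi_mul_intCast]

theorem cos_pi_mul_intCast_sub_half (k : ℤ) : cos (π * (k - 1 / 2)) = 0 := by
  rw [mul_sub, mul_one_div, cos_sub_pi_div_two, sin_pi_mul_intCast]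

theorem hasDerivAt_sin_pi_mul_zero : HasDerivAt (fun z : ℂ => sin (π * z)) π 0 := by
  simpa using ((hasDerivAt_id (0 : ℂ)).const_mul (π : ℂ)).csin

/-- The function `G z = w z * sin (π z) / z` vanishes at the nonzero integers, so that the
alternating sum of `G (k / 2)` over `k` reduces to `k = 0` and the odd `k`. -/
theorem HasExpGrowth.hasSum_neg_one_zpow_mul_div_sub_half {w : ℂ → ℂ}
    (h : HasExpGrowth π (-1) w) (hw : Differentiable ℂ w) :
    HasSum (fun k : ℤ => (-1 : ℂ) ^ k * (w (k - 1 / 2) / (k - 1 / 2))) (-(π * w 0)) := by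
  set G : ℂ → ℂ := fun z => w z * dslope (fun z => sin (π * z)) 0 z with hG
  have hG_zero : G 0 = π * w 0 := by
    simp only [hG]
    rw [dslope_same, hasDerivAt_sin_pi_mul_zero.deriv, mul_comm]
  have hG_ne {z : ℂ} (hz : z ≠ 0) : G z = w z * (sin (π * z) / z) := by
    simp [hG, dslope_of_ne _ hz, slope_def_field]
  have hG_growth : HasExpGrowth π (-2) fun z => G (z / 2) := by
    convert (h.mul (hasExpGrowth_sin_pi_mul.dslope_zero (by simp))).comp_ofReal_mul
      one_half_pos using 1
    · ring
    · norm_num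
    · ext z; rw [hG]; push_cast; rw [one_div_mul_eq_div]
  have hG_diff : Differentiable ℂ fun z => G (z / 2) :=
    (hw.mul (differentiable_dslope (by fun_prop) 0)).comp (by fun_prop)
  have hsum := (hG_growth.hasSum_neg_one_zpow_mul hG_diff).sub (hasSum_ite_eq (0 : ℤ) (G 0))
  have hodd_injective : Function.Injective fun j : ℤ => 2 * j - 1 := fun i j hij => by
    simpa using hij
  rw [← hodd_injective.hasSum_iff, zero_sub, hG_zero] at hsum
  · refine hsum.congr_fun fun j => ?_
    have hhalf : ((2 * j - 1 : ℤ) : ℂ) / 2 = j - 1 / 2 := by push_cast; ring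
    have hodd : Odd (2 * j - 1) := ⟨j - 1, by ring⟩
    rw [Function.comp_apply, if_neg (by omega), hhalf, hG_ne (intCast_sub_half_ne_zero j),
      sin_pi_mul_intCast_sub_half, hodd.neg_one_zpow]
    ring
  · intro k hk
    obtain ⟨j, rfl | rfl⟩ := Int.even_or_odd' k
    · have hhalf : ((2 * j : ℤ) : ℂ) / 2 = j := by push_cast; ring
      rcases eq_or_ne j 0 with rfl | hj
      · simp
      · rw [if_neg (by omega), hhalf, hG_ne (Int.cast_ne_zero.2 hj), sin_pi_mul_intCast]
        simp
    · exact absurd ⟨j + 1, by ring⟩ hk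

/-! ### Taylor quotients and the sampling formulas -/

section Taylor

variable {e h : ℂ → ℂ}

/-- The `n`-th Taylor coefficient of `h` at `0`. -/
noncomputable def taylorCoeff (h : ℂ → ℂ) (n : ℕ) : ℂ := iteratedDeriv n h 0 / n.factorial

/-- The Taylor polynomial of `h` at `0` of degree less than `n`. -/
noncomputable def taylorSum (h : ℂ → ℂ) (n : ℕ) (z : ℂ) : ℂ :=
  ∑ j ∈ Finset.range n, taylorCoeff h j * z ^ j

/-- The quotient `(h z - taylorSum h n z) / z ^ n`, extended across `z = 0` as an iterated
`dslope`. -/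
noncomputable def taylorQuot (h : ℂ → ℂ) (n : ℕ) : ℂ → ℂ := (Function.swap dslope 0)^[n] h

theorem taylorQuot_succ (h : ℂ → ℂ) (n : ℕ) :
    taylorQuot h (n + 1) = dslope (taylorQuot h n) 0 :=
  Function.iterate_succ_apply' _ _ _

theorem differentiable_taylorQuot (hh : Differentiable ℂ h) (n : ℕ) :
    Differentiable ℂ (taylorQuot h n) := by
  induction n with
  | zero => exact hh
  | succ n ih => rw [taylorQuot_succ]; exact differentiable_dslope ih 0

theorem taylorQuot_apply_zero (hh : Differentiable ℂ h) (n : ℕ) :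
    taylorQuot h n 0 = taylorCoeff h n := by
  have hseries := (hh.analyticAt 0).hasFPowerSeriesAt.has_fpower_series_iterate_dslope_fslope n
  rw [taylorQuot, ← hseries.coeff_zero 1]
  change ((FormalMultilinearSeries.fslope^[n]) _).coeff 0 = _
  simp [FormalMultilinearSeries.coeff_iterate_fslope, FormalMultilinearSeries.coeff_ofScalars,
    taylorCoeff]

theorem deriv_taylorQuot_zero (hh : Differentiable ℂ h) (n : ℕ) :
    deriv (taylorQuot h n) 0 = taylorCoeff h (n + 1) := by
  rw [← taylorQuot_apply_zero hh, taylorQuot_succ, dslope_same]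

theorem taylorSum_add_pow_mul_taylorQuot (hh : Differentiable ℂ h) (n : ℕ) (z : ℂ) :
    taylorSum h n z + z ^ n * taylorQuot h n z = h z := by
  induction n with
  | zero => simp [taylorSum, taylorQuot]
  | succ n ih =>
    have hdslope := sub_smul_dslope (taylorQuot h n) 0 z
    rw [sub_zero, smul_eq_mul, taylorQuot_apply_zero hh, ← taylorQuot_succ] at hdslope
    rw [← ih, taylorSum, taylorSum, Finset.sum_range_succ]
    linear_combination z ^ n * hdslope

theorem hasExpGrowth_taylorSum (h : ℂ → ℂ) (n : ℕ) : HasExpGrowth 0 (n - 1) (taylorSum h n) := by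
  refine IsBigO.fun_sum fun j hj => ?_
  have hj : (j : ℤ) ≤ n - 1 := by have := Finset.mem_range.1 hj; omega
  exact ((hasExpGrowth_pow j).const_mul (taylorCoeff h j)).mono hj

/-- The cross product of two functions and their Taylor quotients. At the zeros `z ≠ 0` of `e` it
equals `h z * taylorSum e n z / z ^ n`, which is how the coefficients of the sampling formulas
arise. -/
noncomputable def taylorCross (e h : ℂ → ℂ) (n : ℕ) (z : ℂ) : ℂ :=
  e z * taylorQuot h n z - h z * taylorQuot e n z

theorem differentiable_taylorCross (he : Differentiable ℂ e) (hh : Differentiable ℂ h) (n : ℕ) :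
    Differentiable ℂ (taylorCross e h n) :=
  (he.mul (differentiable_taylorQuot hh n)).sub (hh.mul (differentiable_taylorQuot he n))

theorem pow_mul_taylorCross (he : Differentiable ℂ e) (hh : Differentiable ℂ h) (n : ℕ) (z : ℂ) :
    z ^ n * taylorCross e h n z = h z * taylorSum e n z - e z * taylorSum h n z := by
  rw [taylorCross]
  linear_combination
    e z * taylorSum_add_pow_mul_taylorQuot hh n z - h z * taylorSum_add_pow_mul_taylorQuot he n z

theorem taylorCross_of_eq_zero (he : Differentiable ℂ e) (hh : Differentiable ℂ h) (n : ℕ) {z : ℂ}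
    (hz : z ≠ 0) (hez : e z = 0) : taylorCross e h n z = h z * taylorSum e n z / z ^ n := by
  rw [eq_div_iff (pow_ne_zero n hz), mul_comm, pow_mul_taylorCross he hh, hez]
  ring

theorem taylorCross_apply_zero (he : Differentiable ℂ e) (hh : Differentiable ℂ h) (n : ℕ) :
    taylorCross e h n 0 = e 0 * taylorCoeff h n - h 0 * taylorCoeff e n := by
  rw [taylorCross, taylorQuot_apply_zero hh, taylorQuot_apply_zero he]

theorem deriv_taylorCross_zero (he : Differentiable ℂ e) (hh : Differentiable ℂ h) (n : ℕ) :
    deriv (taylorCross e h n) 0 = deriv e 0 * taylorCoeff h n + e 0 * taylorCoeff h (n + 1) -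
      (deriv h 0 * taylorCoeff e n + h 0 * taylorCoeff e (n + 1)) := by
  have hderiv := ((he 0).hasDerivAt.mul (differentiable_taylorQuot hh n 0).hasDerivAt).sub
    ((hh 0).hasDerivAt.mul (differentiable_taylorQuot he n 0).hasDerivAt)
  simp only [taylorQuot_apply_zero hh, taylorQuot_apply_zero he, deriv_taylorQuot_zero hh,
    deriv_taylorQuot_zero he] at hderiv
  exact hderiv.deriv

theorem hasExpGrowth_taylorCross {σ : ℝ} (he : HasExpGrowth σ 0 e) (hh : HasExpGrowth σ 0 h)
    (hed : Differentiable ℂ e) (hhd : Differentiable ℂ h) (n : ℕ) :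
    HasExpGrowth σ (-1) (taylorCross e h n) := by
  have hnum := (hh.mul (hasExpGrowth_taylorSum e n)).sub (he.mul (hasExpGrowth_taylorSum h n))
  simpa using hnum.of_eventually_pow_mul_eq (.of_forall (pow_mul_taylorCross hed hhd n))

theorem taylorCoeff_sin_pi_mul_even (n : ℕ) :
    taylorCoeff (fun z => sin (π * z)) (2 * n) = 0 := by
  simp [taylorCoeff, iteratedDeriv_comp_const_mul contDiff_sin]

theorem taylorCoeff_sin_pi_mul_odd (n : ℕ) :
    taylorCoeff (fun z => sin (π * z)) (2 * n + 1) =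
      (π : ℂ) ^ (2 * n + 1) * (-1) ^ n / (2 * n + 1).factorial := by
  simp [taylorCoeff, iteratedDeriv_comp_const_mul contDiff_sin]

theorem taylorCoeff_cos_pi_mul_even (n : ℕ) :
    taylorCoeff (fun z => cos (π * z)) (2 * n) =
      (π : ℂ) ^ (2 * n) * (-1) ^ n / (2 * n).factorial := by
  simp [taylorCoeff, iteratedDeriv_comp_const_mul contDiff_cos, iteratedDeriv_even_cos]

theorem taylorCoeff_cos_pi_mul_odd (n : ℕ) :
    taylorCoeff (fun z => cos (π * z)) (2 * n + 1) = 0 := by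
  simp [taylorCoeff, iteratedDeriv_comp_const_mul contDiff_cos]

theorem taylorSum_sin_pi_mul (m : ℕ) (z : ℂ) :
    taylorSum (fun z => sin (π * z)) (2 * m) z =
      ∑ j ∈ Finset.range m, (-1) ^ j * (π * z) ^ (2 * j + 1) / ((2 * j + 1).factorial : ℂ) := by
  induction m with
  | zero => simp [taylorSum]
  | succ m ih =>
    rw [Finset.sum_range_succ, ← ih, taylorSum, mul_add_one, Finset.sum_range_succ,
      Finset.sum_range_succ, taylorCoeff_sin_pi_mul_even, taylorCoeff_sin_pi_mul_odd, taylorSum]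
    ring

theorem taylorSum_cos_pi_mul (m : ℕ) (z : ℂ) :
    taylorSum (fun z => cos (π * z)) (2 * m + 1) z =
      ∑ j ∈ Finset.range (m + 1), (-1) ^ j / ((2 * j).factorial : ℂ) * (π * z) ^ (2 * j) := by
  induction m with
  | zero => simp [taylorSum, taylorCoeff]
  | succ m ih =>
    rw [Finset.sum_range_succ, ← ih, taylorSum, mul_add_one, Finset.sum_range_succ,
      Finset.sum_range_succ, taylorCoeff_cos_pi_mul_odd, ← mul_add_one,
      taylorCoeff_cos_pi_mul_even, taylorSum]
    ring

end Taylor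

section Sampling

variable {h : ℂ → ℂ}

theorem HasExpGrowth.hasSum_coeffB (h_growth : HasExpGrowth π 0 h) (hh : Differentiable ℂ h)
    (m : ℕ) :
    HasSum (fun k : ℤ => (-1 : ℂ) ^ (k + 1) * coeffB m k * h k) (iteratedDeriv (2 * m) h 0) := by
  have he : Differentiable ℂ fun z : ℂ => sin (π * z) := by fun_prop
  set w := taylorCross (fun z => sin (π * z)) h (2 * m) with hw
  have hw_zero : w 0 = 0 := by
    simp [hw, taylorCross_apply_zero he hh, taylorCoeff_sin_pi_mul_even]
  have hw_deriv : deriv w 0 = π * taylorCoeff h (2 * m) -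
      h 0 * ((π : ℂ) ^ (2 * m + 1) * (-1) ^ m / (2 * m + 1).factorial) := by
    rw [hw, deriv_taylorCross_zero he hh, hasDerivAt_sin_pi_mul_zero.deriv,
      taylorCoeff_sin_pi_mul_even, taylorCoeff_sin_pi_mul_odd]
    simp
  have hsum := ((hasExpGrowth_taylorCross hasExpGrowth_sin_pi_mul h_growth he hh
    (2 * m)).dslope_zero hw_zero).hasSum_neg_one_zpow_mul
    (differentiable_dslope (differentiable_taylorCross he hh _) 0)
  have hsum' := (hsum.mul_left (-((2 * m).factorial / π : ℂ))).add
    (hasSum_ite_eq (0 : ℤ) (iteratedDeriv (2 * m) h 0))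
  rw [mul_zero, zero_add] at hsum'
  refine hsum'.congr_fun fun k => ?_
  rw [← hw, zpow_add_one₀ (by norm_num)]
  rcases eq_or_ne k 0 with rfl | hk
  · have hfac : (2 * m + 1 : ℂ) ≠ 0 := by exact_mod_cast (2 * m).succ_ne_zero
    have hfac' : ((2 * m).factorial : ℂ) ≠ 0 := by exact_mod_cast (2 * m).factorial_ne_zero
    have hpi : (π : ℂ) ≠ 0 := ofReal_ne_zero.2 Real.pi_ne_zero
    simp only [Int.cast_zero, dslope_same, hw_deriv, coeffB, if_true, Nat.factorial_succ,
      taylorCoeff]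
    push_cast
    field_simp
    ring
  · have hk' : (k : ℂ) ≠ 0 := Int.cast_ne_zero.2 hk
    rw [dslope_of_ne _ hk', slope_def_field, hw_zero, hw,
      taylorCross_of_eq_zero he hh _ hk' (sin_pi_mul_intCast k), taylorSum_sin_pi_mul, if_neg hk,
      coeffB, if_neg hk]
    push_cast
    field_simp
    ring

theorem HasExpGrowth.hasSum_coeffA (h_growth : HasExpGrowth π 0 h) (hh : Differentiable ℂ h)
    (m : ℕ) :
    HasSum (fun k : ℤ => (-1 : ℂ) ^ (k + 1) * coeffA (m + 1) k * h (k - 1 / 2))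
      (iteratedDeriv (2 * m + 1) h 0) := by
  have he : Differentiable ℂ fun z : ℂ => cos (π * z) := by fun_prop
  set w := taylorCross (fun z => cos (π * z)) h (2 * m + 1) with hw
  have hw_zero : w 0 = taylorCoeff h (2 * m + 1) := by
    simp [hw, taylorCross_apply_zero he hh, taylorCoeff_cos_pi_mul_odd]
  have hfac : ((2 * m + 1).factorial : ℂ) ≠ 0 := by exact_mod_cast (2 * m + 1).factorial_ne_zero
  have hpi : (π : ℂ) ≠ 0 := ofReal_ne_zero.2 Real.pi_ne_zero
  have hsum := ((hasExpGrowth_taylorCross hasExpGrowth_cos_pi_mul h_growth he hh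
    (2 * m + 1)).hasSum_neg_one_zpow_mul_div_sub_half
      (differentiable_taylorCross he hh _)).mul_left (-((2 * m + 1).factorial / π : ℂ))
  have hvalue : -((2 * m + 1).factorial / π : ℂ) * -(π * w 0) = iteratedDeriv (2 * m + 1) h 0 := by
    rw [hw_zero, taylorCoeff]
    field_simp
  rw [← hw, hvalue] at hsum
  refine hsum.congr_fun fun k => ?_
  have hk := intCast_sub_half_ne_zero k
  rw [hw, taylorCross_of_eq_zero he hh _ hk (cos_pi_mul_intCast_sub_half k), taylorSum_cos_pi_mul,
    zpow_add_one₀ (by norm_num), coeffA, show 2 * (m + 1) - 1 = 2 * m + 1 by omega]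
  push_cast
  generalize (k : ℂ) - 1 / 2 = x at hk ⊢
  field_simp
  ring

end Sampling

/-! ### Curves of Bernstein type -/

section Bernstein

/-- A curve `v` is of Bernstein type `σ` if it is smooth and satisfies Bernstein's inequality
`‖v⁽ⁿ⁾ t‖ ≤ C * σ ^ n`. For `v : ℝ → ℂ` these are the restrictions to `ℝ` of the entire functions
of exponential type `σ` that are bounded on `ℝ`. -/
structure IsBernstein {E : Type*} [NormedAddCommGroup E] [NormedSpace ℝ E] (σ : ℝ) (v : ℝ → E) :
    Prop where
  contDiff : ContDiff ℝ ∞ v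
  exists_bound : ∃ C, ∀ n t, ‖iteratedDeriv n v t‖ ≤ C * σ ^ n

variable {E F : Type*} [NormedAddCommGroup E] [NormedSpace ℝ E] [NormedAddCommGroup F]
  [NormedSpace ℝ F] {σ : ℝ} {v : ℝ → E}

theorem iteratedDeriv_clm_comp {𝕜 V W : Type*} [NontriviallyNormedField 𝕜] [NormedAddCommGroup V]
    [NormedSpace 𝕜 V] [NormedAddCommGroup W] [NormedSpace 𝕜 W] (L : V →L[𝕜] W) {v : 𝕜 → V} {n : ℕ}
    {t : 𝕜} (hv : ContDiffAt 𝕜 n v t) :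
    iteratedDeriv n (fun s => L (v s)) t = L (iteratedDeriv n v t) := by
  have hcomp := L.iteratedFDeriv_comp_left hv le_rfl
  simp only [iteratedDeriv_eq_iteratedFDeriv]
  exact DFunLike.congr_fun hcomp _

namespace IsBernstein

theorem contDiff_nat (hv : IsBernstein σ v) (n : ℕ) : ContDiff ℝ n v :=
  hv.contDiff.of_le (by exact_mod_cast le_top)

theorem mono (hv : IsBernstein σ v) {τ : ℝ} (hσ : 0 ≤ σ) (hτ : σ ≤ τ) : IsBernstein τ v := by
  obtain ⟨C, hC⟩ := hv.exists_bound
  have hC0 : 0 ≤ C := by simpa using (norm_nonneg _).trans (hC 0 0)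
  exact ⟨hv.contDiff, C, fun n t => (hC n t).trans (by gcongr)⟩

theorem comp_const_mul (hv : IsBernstein σ v) (c : ℝ) :
    IsBernstein (|c| * σ) fun t => v (c * t) := by
  obtain ⟨C, hC⟩ := hv.exists_bound
  refine ⟨hv.contDiff.comp (by fun_prop), C, fun n t => ?_⟩
  rw [iteratedDeriv_comp_const_smul (hv.contDiff_nat n), norm_smul,
    norm_pow, Real.norm_eq_abs, mul_pow, mul_left_comm]
  gcongr
  exact hC n _

theorem clm_comp (hv : IsBernstein σ v) (L : E →L[ℝ] F) : IsBernstein σ fun t => L (v t) := by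
  obtain ⟨C, hC⟩ := hv.exists_bound
  refine ⟨L.contDiff.comp hv.contDiff, ‖L‖ * C, fun n t => ?_⟩
  rw [iteratedDeriv_clm_comp L (hv.contDiff_nat n).contDiffAt, mul_assoc]
  exact L.le_opNorm_of_le (hC n t)

theorem tendsto_taylorWithinEval (hv : IsBernstein σ v) {s : ℝ} (hs : 0 ≤ s) :
    Tendsto (fun n => taylorWithinEval v n (Icc 0 (s + 1)) 0 s) atTop (𝓝 (v s)) := by
  obtain ⟨C, hC⟩ := hv.exists_bound
  have hs' : 0 < s + 1 := by linarith
  have hremainder (n : ℕ) : ‖taylorWithinEval v n (Icc 0 (s + 1)) 0 s - v s‖ ≤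
      C * σ * s * ((σ * s) ^ n / n.factorial) := by
    rw [norm_sub_rev]
    refine (taylor_mean_remainder_bound (C := C * σ ^ (n + 1)) hs'.le
      (hv.contDiff_nat (n + 1)).contDiffOn ⟨hs, by linarith⟩
      fun y hy => ?_).trans_eq (by ring)
    rw [iteratedDerivWithin_eq_iteratedDeriv (uniqueDiffOn_Icc hs')
      (hv.contDiff_nat _).contDiffAt hy]
    exact hC _ _
  rw [tendsto_iff_norm_sub_tendsto_zero]
  exact squeeze_zero (fun _ => norm_nonneg _) hremainder <| by
    simpa using (FloorSemiring.tendsto_pow_div_factorial_atTop (σ * s)).const_mul (C * σ * s)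

theorem hasSum_taylor [CompleteSpace E] (hv : IsBernstein σ v) (s : ℝ) :
    HasSum (fun n : ℕ => (s ^ n / n.factorial) • iteratedDeriv n v 0) (v s) := by
  wlog hs : 0 ≤ s generalizing v s
  · have hneg_type : IsBernstein σ fun t => v (-t) := by simpa using hv.comp_const_mul (-1)
    have hneg := this hneg_type (s := -s) (by linarith)
    simp only [neg_neg] at hneg
    refine hneg.congr_fun fun n => ?_
    rw [iteratedDeriv_comp_neg, neg_zero, smul_smul, neg_pow, div_mul_eq_mul_div, mul_right_comm,
      ← mul_pow, neg_one_mul, neg_neg, one_pow, one_mul]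
  obtain ⟨C, hC⟩ := hv.exists_bound
  have hsummable : Summable fun n : ℕ => (s ^ n / n.factorial) • iteratedDeriv n v 0 := by
    refine .of_norm_bounded ((Real.summable_pow_div_factorial (s * σ)).mul_left C) fun n => ?_
    rw [norm_smul, Real.norm_of_nonneg (by positivity), mul_pow]
    calc s ^ n / n.factorial * ‖iteratedDeriv n v 0‖ ≤ s ^ n / n.factorial * (C * σ ^ n) := by
          gcongr; exact hC n 0
      _ = C * (s ^ n * σ ^ n / n.factorial) := by ring
  have hpartial (n : ℕ) : taylorWithinEval v n (Icc 0 (s + 1)) 0 s =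
      ∑ j ∈ Finset.range (n + 1), (s ^ j / j.factorial) • iteratedDeriv j v 0 := by
    rw [taylor_within_apply]
    refine Finset.sum_congr rfl fun j _ => ?_
    rw [iteratedDerivWithin_eq_iteratedDeriv (uniqueDiffOn_Icc (by linarith))
      (hv.contDiff_nat _).contDiffAt ⟨le_rfl, by linarith⟩, sub_zero,
      div_eq_inv_mul]
  have hlim := hv.tendsto_taylorWithinEval hs
  simp only [hpartial] at hlim
  exact hsummable.hasSum_iff.2 (tendsto_nhds_unique
    ((tendsto_add_atTop_iff_nat 1).2 hsummable.hasSum.tendsto_sum_nat) hlim)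

end IsBernstein

theorem differentiable_tsum_pow_div_factorial {a : ℕ → ℂ} {C : ℝ} (ha : ∀ n, ‖a n‖ ≤ C * σ ^ n) :
    Differentiable ℂ fun z : ℂ => ∑' n : ℕ, z ^ n / n.factorial * a n := fun z => by
  have hon : DifferentiableOn ℂ (fun z : ℂ => ∑' n : ℕ, z ^ n / n.factorial * a n)
      (Metric.ball 0 (‖z‖ + 1)) := by
    refine differentiableOn_tsum_of_summable_norm
      ((Real.summable_pow_div_factorial ((‖z‖ + 1) * σ)).mul_left C) (fun n => by fun_prop)
      Metric.isOpen_ball fun n w hw => ?_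
    rw [norm_mul, norm_div, norm_pow, norm_natCast, mul_pow]
    calc ‖w‖ ^ n / n.factorial * ‖a n‖ ≤ (‖z‖ + 1) ^ n / n.factorial * (C * σ ^ n) := by
          gcongr
          · exact (mem_ball_zero_iff.1 hw).le
          · exact ha n
      _ = C * ((‖z‖ + 1) ^ n * σ ^ n / n.factorial) := by ring
  exact hon.differentiableAt (Metric.isOpen_ball.mem_nhds (by simp))

theorem IsBernstein.exists_differentiable_extension {v : ℝ → ℂ} (hv : IsBernstein σ v) :
    ∃ h : ℂ → ℂ, Differentiable ℂ h ∧ ∀ t : ℝ, h t = v t := by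
  obtain ⟨C, hC⟩ := hv.exists_bound
  refine ⟨_, differentiable_tsum_pow_div_factorial fun n => hC n 0, fun t => ?_⟩
  simpa using (hv.hasSum_taylor t).tsum_eq

theorem iteratedDeriv_comp_ofReal {h : ℂ → ℂ} (hh : Differentiable ℂ h) (n : ℕ) (t : ℝ) :
    iteratedDeriv n (fun s : ℝ => h s) t = iteratedDeriv n h t := by
  induction n generalizing t with
  | zero => simp
  | succ n ih =>
    have hd : DifferentiableAt ℂ (iteratedDeriv n h) t :=
      (hh.contDiff (n := (n + 1 : ℕ))).differentiable_iteratedDeriv n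
        (by exact_mod_cast n.lt_succ_self) _
    rw [iteratedDeriv_succ, iteratedDeriv_succ, funext ih, hd.hasDerivAt.comp_ofReal.deriv]

theorem IsBernstein.hasExpGrowth {h : ℂ → ℂ} (hv : IsBernstein σ fun t : ℝ => h t)
    (hh : Differentiable ℂ h) : HasExpGrowth σ 0 h := by
  obtain ⟨C, hC⟩ := hv.exists_bound
  refine IsBigO.of_bound C (.of_forall fun z => ?_)
  rw [zpow_zero, one_mul, Real.norm_of_nonneg (Real.exp_pos _).le, Real.exp_eq_exp_ℝ,
    ← (hasSum_taylorSeries_of_entire hh (z.re : ℂ) z).tsum_eq]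
  refine tsum_of_norm_bounded
    ((NormedSpace.expSeries_div_hasSum_exp (σ * |z.im|)).mul_left C) fun n => ?_
  have hdist : ‖z - z.re‖ = |z.im| := by
    rw [sub_eq_iff_eq_add'.2 (re_add_im z).symm]; simp
  rw [smul_eq_mul, smul_eq_mul, norm_mul, norm_mul, norm_inv, norm_natCast, norm_pow, hdist,
    ← iteratedDeriv_comp_ofReal hh]
  calc (n.factorial : ℝ)⁻¹ * (|z.im| ^ n * ‖iteratedDeriv n (fun s : ℝ => h s) z.re‖)
      ≤ (n.factorial : ℝ)⁻¹ * (|z.im| ^ n * (C * σ ^ n)) := by gcongr; exact hC n _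
    _ = C * ((σ * |z.im|) ^ n / n.factorial) := by rw [mul_pow]; ring

end Bernstein

section BoasFormula

/-- The formula `h⁽ⁿ⁾(0) = ∑ k, a k * h (x k)` holds, with unconditional convergence, for every
entire function `h` of exponential type `π` that is bounded on `ℝ`. -/
def IsBoasFormula {ι : Type*} (n : ℕ) (a x : ι → ℝ) : Prop :=
  ∀ h : ℂ → ℂ, Differentiable ℂ h → HasExpGrowth π 0 h →
    HasSum (fun k => (a k : ℂ) * h (x k)) (iteratedDeriv n h 0)

theorem isBoasFormula_coeffB (m : ℕ) :
    IsBoasFormula (2 * m) (fun k : ℤ => (-1) ^ (k + 1) * coeffB m k) fun k => k :=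
  fun h hh h_growth => by simpa using h_growth.hasSum_coeffB hh m

theorem isBoasFormula_coeffA (m : ℕ) :
    IsBoasFormula (2 * m + 1) (fun k : ℤ => (-1) ^ (k + 1) * coeffA (m + 1) k)
      fun k => k - 1 / 2 :=
  fun h hh h_growth => by simpa using h_growth.hasSum_coeffA hh m

variable {ι : Type*} {n : ℕ} {a x : ι → ℝ}

theorem IsBoasFormula.summable (hax : IsBoasFormula n a x) : Summable a := by
  have hexp : HasExpGrowth π 0 fun z => exp (π * z * I) := by
    simpa using hasExpGrowth_exp_mul_I.comp_ofReal_mul Real.pi_pos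
  have hsum := (hax _ (by fun_prop) hexp).summable.norm
  simp only [norm_mul, norm_real, ← ofReal_mul, norm_exp_ofReal_mul_I, mul_one] at hsum
  exact hsum.of_norm

theorem hasSum_of_summable_of_forall_dual {𝕜 E : Type*} [RCLike 𝕜] [NormedAddCommGroup E]
    [NormedSpace 𝕜 E] {u : ι → E} {b : E} (hu : Summable u)
    (hb : ∀ φ : StrongDual 𝕜 E, HasSum (fun i => φ (u i)) (φ b)) : HasSum u b := by
  refine hu.hasSum_iff.2 ((SeparatingDual.eq_iff_forall_dual_eq (R := 𝕜)).2 fun φ => ?_)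
  exact (hu.hasSum.mapL φ).unique (hb φ)

variable {E : Type*} [NormedAddCommGroup E] [NormedSpace ℂ E] [CompleteSpace E] {σ : ℝ} {v : ℝ → E}

theorem IsBoasFormula.hasSum_smul (hax : IsBoasFormula n a x) (hv : IsBernstein π v) :
    HasSum (fun k => a k • v (x k)) (iteratedDeriv n v 0) := by
  obtain ⟨C, hC⟩ := hv.exists_bound
  have hsummable : Summable fun k => a k • v (x k) := by
    refine .of_norm_bounded (hax.summable.norm.mul_right C) fun k => ?_
    rw [norm_smul]
    gcongr
    simpa using hC 0 (x k)
  refine hasSum_of_summable_of_forall_dual (𝕜 := ℂ) hsummable fun φ => ?_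
  obtain ⟨h, hh, hhv⟩ := (hv.clm_comp (φ.restrictScalars ℝ)).exists_differentiable_extension
  have hhv' : (fun t : ℝ => h t) = fun t => φ.restrictScalars ℝ (v t) := funext hhv
  have hh_bernstein : IsBernstein π fun t : ℝ => h t := hhv' ▸ hv.clm_comp (φ.restrictScalars ℝ)
  have hsum := hax h hh (hh_bernstein.hasExpGrowth hh)
  rw [← ofReal_zero, ← iteratedDeriv_comp_ofReal hh, hhv',
    iteratedDeriv_clm_comp _ (hv.contDiff_nat n).contDiffAt] at hsum
  refine hsum.congr_fun fun k => ?_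
  rw [φ.map_smul_of_tower, real_smul, hhv]
  rfl

theorem IsBoasFormula.hasSum_smul_div_pi (hax : IsBoasFormula n a x) (hσ : 0 < σ)
    (hv : IsBernstein σ v) :
    HasSum (fun k => ((σ / π) ^ n * a k) • v (π / σ * x k)) (iteratedDeriv n v 0) := by
  have hscaled : IsBernstein π fun t => v (π / σ * t) := by
    convert hv.comp_const_mul (π / σ) using 1
    rw [abs_of_pos (by positivity), div_mul_cancel₀ _ hσ.ne']
  have hsum := (hax.hasSum_smul hscaled).const_smul ((σ / π) ^ n)
  have hinv : σ / π * (π / σ) = 1 := by field_simp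
  simp only [iteratedDeriv_comp_const_smul (hv.contDiff_nat n), mul_zero,
    smul_smul] at hsum
  rw [← mul_pow, hinv, one_pow, one_smul] at hsum
  exact hsum

end BoasFormula

/-! ### The translation group -/

section MellinTranslation

variable {p : ℝ≥0∞} {f : X p}

theorem norm_U (t : ℝ) (f : X p) : ‖U t f‖ = ‖f‖ :=
  Lp.norm_compMeasurePreserving f (measurePreserving_dilation t)

theorem U_zero (f : X p) : U 0 f = f := by
  simp only [U, Real.exp_zero, one_mul]
  exact Lp.compMeasurePreserving_id_apply f

theorem U_add (t s : ℝ) (f : X p) : U (t + s) f = U t (U s f) := by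
  have hdilation : (fun x : ℝ => Real.exp (t + s) * x) =
      (fun x => Real.exp s * x) ∘ fun x => Real.exp t * x := by
    ext x
    rw [Function.comp_apply, Real.exp_add, mul_left_comm, mul_assoc]
  unfold U
  rw [← Lp.compMeasurePreserving_comp_apply]
  congr!

variable [Fact (1 ≤ p)]

theorem hasDerivAt_U (hf : InDomain f) (t : ℝ) : HasDerivAt (fun s => U s f) (U t (Theta f)) t := by
  have hzero : HasDerivAt (fun s => U s f) (Theta f) 0 := DifferentiableAt.hasDerivAt hf
  let L : X p →L[ℝ] X p := (Lp.compMeasurePreservingₗᵢ ℝ _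
    (measurePreserving_dilation t)).toContinuousLinearMap
  have hshifted : HasDerivAt (fun s => U t (U s f)) (U t (Theta f)) 0 :=
    L.hasFDerivAt.comp_hasDerivAt (0 : ℝ) hzero
  simp only [← U_add] at hshifted
  rw [← neg_add_cancel t] at hshifted
  simpa using hshifted.comp_const_add (-t) t

theorem iteratedDeriv_U (hf : f ∈ domainInfty) (n : ℕ) (t : ℝ) :
    iteratedDeriv n (fun s => U s f) t = U t (Theta^[n] f) := by
  induction n generalizing t with
  | zero => simp
  | succ n ih =>
    have hdom : InDomain (Theta^[n] f) := mem_iInter.1 hf (n + 1) n n.lt_succ_self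
    rw [iteratedDeriv_succ, funext ih, (hasDerivAt_U hdom t).deriv, Function.iterate_succ_apply']

theorem isBernstein_U {σ : ℝ} (hf : f ∈ bernstein p σ) : IsBernstein σ fun t => U t f := by
  refine ⟨contDiff_of_differentiable_iteratedDeriv fun n _ t => ?_, ‖f‖, fun n t => ?_⟩
  · rw [funext (iteratedDeriv_U hf.1 n)]
    exact (hasDerivAt_U (mem_iInter.1 hf.1 (n + 1) n n.lt_succ_self) t).differentiableAt
  · rw [iteratedDeriv_U hf.1, norm_U, mul_comm]
    exact hf.2 n

theorem hasSum_rieszBoasTerm {σ τ : ℝ} (hf : f ∈ bernstein p σ) (hσ : 0 < σ) (hτ : σ ≤ τ) (r : ℕ) :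
    HasSum (rieszBoasTerm r τ f) (Theta^[r] f) := by
  have hU := (isBernstein_U hf).mono hσ.le hτ
  have hderiv : iteratedDeriv r (fun t => U t f) 0 = Theta^[r] f := by
    rw [iteratedDeriv_U hf.1, U_zero]
  rw [← hderiv]
  obtain ⟨m, rfl | rfl⟩ := Nat.even_or_odd' r
  · refine ((isBoasFormula_coeffB m).hasSum_smul_div_pi (hσ.trans_le hτ) hU).congr_fun fun k => ?_
    rw [rieszBoasTerm, if_neg (by simp), Nat.mul_div_cancel_left m two_pos, div_mul_eq_mul_div]
    rfl
  · refine ((isBoasFormula_coeffA m).hasSum_smul_div_pi (hσ.trans_le hτ) hU).congr_fun fun k => ?_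
    rw [rieszBoasTerm, if_pos ⟨m, rfl⟩, show (2 * m + 1 + 1) / 2 = m + 1 by omega]
    rfl

end MellinTranslation

end Mellin11

theorem mainTheorem11_general (p : ENNReal) [Fact (1 ≤ p)] (σ : ℝ) (hσ : 0 < σ)
    (f : Mellin11.X p) (hf : f ∈ Mellin11.bernstein p σ) (σ₁ σ₂ : ℝ) (h₁ : σ ≤ σ₁) (h₂ : σ ≤ σ₂)
    (r : ℕ) :
    Summable (Mellin11.rieszBoasTerm r σ₁ f) ∧ Summable (Mellin11.rieszBoasTerm r σ₂ f) ∧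
      Mellin11.rieszBoas r σ₁ f = Mellin11.rieszBoas r σ₂ f := by
  have hsum₁ := Mellin11.hasSum_rieszBoasTerm hf hσ h₁ r
  have hsum₂ := Mellin11.hasSum_rieszBoasTerm hf hσ h₂ r
  exact ⟨hsum₁.summable, hsum₂.summable, hsum₁.tsum_eq.trans hsum₂.tsum_eq.symm⟩

theorem mainTheorem11 (p : ENNReal) [Fact (1 ≤ p)] (hp1 : 1 < p) (hp : p < ⊤)
    (σ : ℝ) (hσ : 0 < σ) (f : Mellin11.X p) (hf : f ∈ Mellin11.bernstein p σ)
    (σ₁ σ₂ : ℝ) (h₁ : σ ≤ σ₁) (h₂ : σ ≤ σ₂) (r : ℕ) (hr : 1 ≤ r) :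
    Summable (Mellin11.rieszBoasTerm r σ₁ f) ∧
      Summable (Mellin11.rieszBoasTerm r σ₂ f) ∧
      Mellin11.rieszBoas r σ₁ f = Mellin11.rieszBoas r σ₂ f :=
  mainTheorem11_general p σ hσ f hf σ₁ σ₂ h₁ h₂ r
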